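/- Let $d\ge 1$, and let $\Omega\subset\mathbb{R}^d$ be a non-empty bounded connected open set which satisfies an interior cone condition and has a Lipschitz boundary (in Stein's sense: there are $\varepsilon>0$, $N\in\mathbb{N}$, $M\ge 0$ and open sets $U_1,U_2,\dots$ such that every ball $B(x,\varepsilon)$ with $x\in\partial\Omega$ lies in some $U_k$, no point lies in more than $N$ of the $U_k$, and each $U_k\cap\Omega$ equals $U_k\cap D_k$, where $D_k$ is, up to a rotation, the region above the graph of an $M$-Lipschitz function). For a sequence $(x_i)_{i\ge1}$ in $\bar\Omega$ let $X_n=\{x_1,\dots,x_n\}$ and $h_n=\sup_{y\in\bar\Omega}\min_{1\le i\le n}\|y-x_i\|$. Suppose that the sequence is quasi-uniform on $\bar\Omega$, that is, there are positive constants $c_{\rm qu},c_{\rm qu}',\rho$ such that $$c_{\rm qu}\,n^{-1/d}\le h_n\le c_{\rm qu}'\,n^{-1/d}\quad\text{for all } n\ge 1,\qquad \|x_i-x_j\|\ge\rho\,h_n\quad\text{for all } n\ge 2 \text{ and } 1\le i<j\le n .$$ Fix $\sigma,\lambda>0$ and a function $c:(0,\infty)\to(0,\infty)$ such that $\inf_{\nu\in(0,a]}c(\nu)>0$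 for every $a>0$. For $\nu>0$ let $K_\nu(x,y)=\Phi_\nu(x-y)$ be the Matérn kernel on $\mathbb{R}^d$, $$\Phi_\nu(z)=\sigma^2c(\nu)\Big(\frac{\sqrt{2\nu}\,\|z\|}{\lambda}\Big)^{\nu}\mathcal{K}_\nu\Big(\frac{\sqrt{2\nu}\,\|z\|}{\lambda}\Big)\quad(z\ne0),\qquad \Phi_\nu(0)=\sigma^2c(\nu)2^{\nu-1}\Gamma(\nu),$$ where $\mathcal{K}_\nu$ is the modified Bessel function of the second kind. For a finite set $X$ of distinct points let $$\mathbb{V}_\nu(x\mid X)=K_\nu(x,x)-K_\nu(x,X)^{\mathsf T}K_\nu(X)^{-1}K_\nu(X,x)$$ be the conditional variance (equal to $K_\nu(x,x)$ if $X=\emptyset$), and let $X_n^i=X_n\setminus\{x_i\}$. Then for every $\nu_1>0$ there are positive constants $C_2$ and $n_0$ such that $$\min_{1\le i\le n}\mathbb{V}_\nu(x_i\mid X_n^i)\ \ge\ C_2\,n^{-2\nu_1/d}\qquad\text{for all } n\ge n_0 \text{ and all } \nu\in(0,\nu_1].$$ -/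

import Mathlib

noncomputable section

namespace MaternLower

/-- Euclidean space of dimension `d`. -/
abbrev Euc (d : ℕ) : Type := EuclideanSpace ℝ (Fin d)

/-- The modified Bessel function of the second kind of order `ν` (Macdonald function), for `z > 0`,
through the classical integral
`K_ν(z) = (1/2) (z/2)^ν ∫_0^∞ t^(-ν-1) exp(-t - z²/(4t)) dt`. -/
def besselK (ν z : ℝ) : ℝ :=
  (1 / 2) * (z / 2) ^ ν *
    ∫ t in Set.Ioi (0 : ℝ), t ^ (-ν - 1) * Real.exp (-t - z ^ 2 / (4 * t))

/-- The radial profile `r ↦ r^ν K_ν(r)`, with its limit value `2^(ν-1) Γ(ν)` at `r = 0`. -/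
def maternProfile (ν r : ℝ) : ℝ :=
  if r = 0 then 2 ^ (ν - 1) * Real.Gamma ν else r ^ ν * besselK ν r

/-- The Matérn kernel on `ℝ^d` with magnitude `σ`, scale `lam`, smoothness `ν` and
smoothness-dependent scaling factor `c ν`. -/
def maternKernel {d : ℕ} (σ lam : ℝ) (c : ℝ → ℝ) (ν : ℝ) (x y : Euc d) : ℝ :=
  σ ^ 2 * c ν * maternProfile ν (Real.sqrt (2 * ν) * ‖x - y‖ / lam)

/-- The kernel matrix of a finite family of points. -/
def kernelMatrix {E ι : Type*} (K : E → E → ℝ) (X : ι → E) : Matrix ι ι ℝ :=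
  Matrix.of fun i j => K (X i) (X j)

/-- The conditional variance `K(x,x) - K(x,X)ᵀ K(X)⁻¹ K(X,x)` at `x` given the points `X`;
for the empty family it is `K(x,x)`. -/
def condVar {E ι : Type*} [Fintype ι] [DecidableEq ι] (K : E → E → ℝ) (X : ι → E) (x : E) : ℝ :=
  K x x - (fun i => K x (X i)) ⬝ᵥ Matrix.mulVec (kernelMatrix K X)⁻¹ (fun i => K (X i) x)

/-- The leave-one-out conditional variance at the point `x i`, given the first `n` points of the
sequence with the `i`-th one removed (indices run through `0, …, n - 1`). -/
def looVar {E : Type*} (K : E → E → ℝ) (x : ℕ → E) (n : ℕ) (i : Fin n) : ℝ :=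
  condVar K (fun j : {j : Fin n // j ≠ i} => x j.1) (x i)

/-- The interior cone condition: cones of a fixed angle `θ` and radius `r` with vertex at any point
of `Ω` fit into `Ω`. -/
def InteriorCone {d : ℕ} (Ω : Set (Euc d)) : Prop :=
  ∃ θ ∈ Set.Ioo 0 (Real.pi / 2), ∃ r > 0, ∀ x ∈ Ω, ∃ ξ : Euc d, ‖ξ‖ = 1 ∧
    ∀ y : Euc d, ‖y‖ = 1 → Real.cos θ ≤ inner ℝ y ξ →
      ∀ t ∈ Set.Icc 0 r, x + t • y ∈ Ω

/-- A special Lipschitz domain with bound `M`: up to a rotation, the set of points above the graph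
of an `M`-Lipschitz function; `e` is the upward direction. -/
def SpecialLipschitz {d : ℕ} (M : NNReal) (D : Set (Euc d)) : Prop :=
  ∃ e : Euc d, ‖e‖ = 1 ∧ ∃ φ : (Submodule.span ℝ {e})ᗮ → ℝ, LipschitzWith M φ ∧
    D = {x | φ ((Submodule.span ℝ {e})ᗮ.orthogonalProjectionOnto x) < inner ℝ x e}

/-- Lipschitz boundary in the sense of Stein (minimally smooth boundary): near its boundary, `Ω`
coincides locally with special Lipschitz domains, with uniform bounds. -/
def LipschitzBoundary {d : ℕ} (Ω : Set (Euc d)) : Prop :=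
  ∃ ε > 0, ∃ N : ℕ, ∃ M : NNReal, ∃ U : ℕ → Set (Euc d),
    (∀ k, IsOpen (U k)) ∧
    (∀ x ∈ frontier Ω, ∃ k, Metric.ball x ε ⊆ U k) ∧
    (∀ x, {k | x ∈ U k}.encard ≤ N) ∧
    (∀ k, ∃ D, SpecialLipschitz M D ∧ U k ∩ Ω = U k ∩ D)

/-- The standing assumption on the domain. -/
structure IsAdmissibleDomain {d : ℕ} (Ω : Set (Euc d)) : Prop where
  isOpen : IsOpen Ω
  isConnected : IsConnected Ω
  isBounded : Bornology.IsBounded Ω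
  interiorCone : InteriorCone Ω
  lipschitzBoundary : LipschitzBoundary Ω

/-- The fill-distance `sup_{y ∈ A} min_{i < n} ‖y - x i‖` in `A` of the first `n` points of a
sequence (for a bounded set `A` and `n ≥ 1`). -/
def fillDist {d : ℕ} (A : Set (Euc d)) (x : ℕ → Euc d) (n : ℕ) : ℝ :=
  ⨆ y : A, ⨅ i : Fin n, ‖(y : Euc d) - x i‖

/-- Quasi-uniformity of a sequence of points on `A`: the fill-distance is of the exact order
`n^(-1/d)`, and the distance between the two nearest of the first `n` points is at least a fixed
multiple of the fill-distance. In particular the points are distinct. -/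
structure IsQuasiUniform {d : ℕ} (A : Set (Euc d)) (x : ℕ → Euc d) : Prop where
  mem : ∀ i, x i ∈ A
  fill : ∃ a > 0, ∃ b > 0, ∀ n : ℕ, 1 ≤ n →
    a * (n : ℝ) ^ (-1 / (d : ℝ)) ≤ fillDist A x n ∧
      fillDist A x n ≤ b * (n : ℝ) ^ (-1 / (d : ℝ))
  sep : ∃ ρ > 0, ∀ n : ℕ, ∀ i j : Fin n, i ≠ j → ρ * fillDist A x n ≤ ‖x i - x j‖

end MaternLower

end

noncomputable section

namespace MaternLower

open MeasureTheory Set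

/-! ### Gaussian kernels: positive semidefiniteness, and coercivity on separated points. -/

section Gaussian

variable {d : ℕ} {ι : Type*} [Fintype ι]

/-! The Matérn kernel is a mixture over `s > 0`, with weight `s^(ν-1) exp(-s)`, of the Gaussians
`exp(-b ‖x-y‖²/s)`, where `b = ν/(2 lam²)` (`maternProfile_eq_integral`). Every Gaussian gives a
non-negative form, so large `s` may be dropped. If the points are `q`-separated and `s ≤ s₀ = b
q²/A`, the Gaussian is so narrow that its matrix is diagonally dominant, with form at least
`‖v‖²/2`. Hence the Matérn form is at least a multiple of `exp(-s₀) (s₀^ν/ν) ‖v‖²`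
(`exists_matern_form_ge`).

A leave-one-out variance is a Schur complement, so it inherits this bound (`condVar_erase_ge`).
Quasi-uniformity gives `q` of order `n^(-1/d)`, and `exp_mul_rpow_div_ge` makes the constant uniform
in `ν ≤ ν₁`; there `ν^ν ≥ exp(-1)` prevents degeneration as `ν → 0`. -/

theorem integrable_exp_neg_mul_sq_norm {b : ℝ} (hb : 0 < b) :
    Integrable fun z : Euc d => Real.exp (-b * ‖z‖ ^ 2) := by
  have h := GaussianFourier.integrable_cexp_neg_mul_sq_norm_add (V := Euc d) (b := (b : ℂ))
    (by simpa using hb) 0 0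
  refine h.re.congr (Filter.Eventually.of_forall fun z => ?_)
  simp only [zero_mul, add_zero]
  norm_cast

theorem integral_exp_neg_mul_sq_norm_pos {b : ℝ} (hb : 0 < b) :
    0 < ∫ z : Euc d, Real.exp (-b * ‖z‖ ^ 2) := by
  exact integral_exp_pos (integrable_exp_neg_mul_sq_norm hb)

/-- The parallelogram law completes the square around the midpoint; integrating over `z` then
exhibits a Gaussian as a convolution of two narrower ones. -/
theorem exp_mul_exp_eq (a : ℝ) (x y z : Euc d) :
    Real.exp (-(2 * a) * ‖z - x‖ ^ 2) * Real.exp (-(2 * a) * ‖z - y‖ ^ 2) =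
      Real.exp (-a * ‖x - y‖ ^ 2) *
        Real.exp (-(4 * a) * ‖z - (1 / 2 : ℝ) • (x + y)‖ ^ 2) := by
  have h := parallelogram_law_with_norm ℝ (z - x) (z - y)
  have h1 : z - x + (z - y) = (2 : ℝ) • (z - (1 / 2 : ℝ) • (x + y)) := by
    module
  have h2 : z - x - (z - y) = -(x - y) := by abel
  rw [h1, h2, norm_neg, norm_smul] at h
  simp only [Real.norm_ofNat] at h
  rw [← Real.exp_add, ← Real.exp_add]
  congr 1
  linear_combination a * h

/-- The Gaussian kernel is positive semidefinite. -/
theorem gaussian_form_nonneg {a : ℝ} (ha : 0 < a) (X : ι → Euc d) (v : ι → ℝ) :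
    0 ≤ ∑ i, ∑ j, v i * v j * Real.exp (-a * ‖X i - X j‖ ^ 2) := by
  set I := ∫ z : Euc d, Real.exp (-(4 * a) * ‖z‖ ^ 2)
  have hI : 0 < I := integral_exp_neg_mul_sq_norm_pos (by positivity)
  have hint (i j : ι) : Integrable fun z : Euc d => v i * v j *
      (Real.exp (-(2 * a) * ‖z - X i‖ ^ 2) * Real.exp (-(2 * a) * ‖z - X j‖ ^ 2)) := by
    simp only [exp_mul_exp_eq]
    exact (((integrable_exp_neg_mul_sq_norm (by positivity : 0 < 4 * a)).comp_sub_right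
      ((1 / 2 : ℝ) • (X i + X j))).const_mul _).const_mul _
  -- The form is, up to the factor `I`, the squared `L²` norm of a sum of Gaussian bumps.
  have key : (∑ i, ∑ j, v i * v j * Real.exp (-a * ‖X i - X j‖ ^ 2)) * I =
      ∫ z : Euc d, (∑ i, v i * Real.exp (-(2 * a) * ‖z - X i‖ ^ 2)) ^ 2 := by
    have h1 (z : Euc d) : (∑ i, v i * Real.exp (-(2 * a) * ‖z - X i‖ ^ 2)) ^ 2 =
        ∑ i, ∑ j, v i * v j *
          (Real.exp (-(2 * a) * ‖z - X i‖ ^ 2) * Real.exp (-(2 * a) * ‖z - X j‖ ^ 2)) := by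
      rw [sq, Finset.sum_mul_sum]
      exact Finset.sum_congr rfl fun i _ => Finset.sum_congr rfl fun j _ => by ring
    simp only [h1]
    rw [integral_finsetSum _ fun i _ => integrable_finsetSum _ fun j _ => hint i j,
      Finset.sum_mul]
    refine Finset.sum_congr rfl fun i _ => ?_
    rw [integral_finsetSum _ fun j _ => hint i j, Finset.sum_mul]
    refine Finset.sum_congr rfl fun j _ => ?_
    simp only [exp_mul_exp_eq]
    rw [integral_const_mul, integral_const_mul,
      integral_sub_right_eq_self (fun z : Euc d => Real.exp (-(4 * a) * ‖z‖ ^ 2)), mul_assoc]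
  have h2 : 0 ≤ (∑ i, ∑ j, v i * v j * Real.exp (-a * ‖X i - X j‖ ^ 2)) * I :=
    key ▸ integral_nonneg fun z => sq_nonneg _
  exact nonneg_of_mul_nonneg_left h2 hI

/-- A Gaussian sum over `1`-separated points is bounded by a constant that depends only on the
dimension. -/
theorem exists_sum_exp_neg_sq_norm_le (d : ℕ) :
    ∃ C : ℝ, 0 < C ∧ ∀ {ι : Type} (s : Finset ι) (y : ι → Euc d),
      (∀ i ∈ s, ∀ j ∈ s, i ≠ j → 1 ≤ ‖y i - y j‖) → ∑ i ∈ s, Real.exp (-‖y i‖ ^ 2) ≤ C := by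
  set I := ∫ z : Euc d, Real.exp (-(1 / 2) * ‖z‖ ^ 2)
  have hint : Integrable fun z : Euc d => Real.exp (-(1 / 2) * ‖z‖ ^ 2) :=
    integrable_exp_neg_mul_sq_norm (by norm_num)
  have hI : 0 < I := integral_exp_neg_mul_sq_norm_pos (by norm_num)
  set V := volume.real (Metric.ball (0 : Euc d) (1 / 2))
  have hV : 0 < V := ENNReal.toReal_pos
    (Metric.measure_ball_pos volume _ (by norm_num)).ne' measure_ball_lt_top.ne
  have hvol (y : Euc d) : volume.real (Metric.ball y (1 / 2)) = V := by
    simp only [V, measureReal_def, Measure.addHaar_ball_center]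
  -- Each term is compared with an integral over the ball of radius `1/2` about `y i`; these balls
  -- are disjoint. The factor `exp(1/4)` comes from `‖z‖²/2 ≤ ‖y i‖² + 1/4` on that ball.
  refine ⟨Real.exp (1 / 4) * I / V, by positivity, fun s y hy => ?_⟩
  rw [le_div_iff₀ hV]
  have hball (i) : Real.exp (-‖y i‖ ^ 2) * V ≤ Real.exp (1 / 4) *
      ∫ z in Metric.ball (y i) (1 / 2), Real.exp (-(1 / 2) * ‖z‖ ^ 2) := by
    rw [← integral_const_mul, ← hvol (y i), mul_comm, ← smul_eq_mul, ← setIntegral_const]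
    refine setIntegral_mono_on (integrableOn_const measure_ball_lt_top.ne)
      (hint.integrableOn.const_mul _) measurableSet_ball fun z hz => ?_
    rw [← Real.exp_add, Real.exp_le_exp]
    have h1 : ‖z - y i‖ < 1 / 2 := by simpa [dist_eq_norm] using hz
    have h2 : ‖z‖ ≤ ‖y i‖ + 1 / 2 := by
      have := norm_add_le (y i) (z - y i)
      rw [add_sub_cancel] at this
      linarith
    nlinarith [norm_nonneg z, norm_nonneg (y i), sq_nonneg (‖y i‖ - 1 / 2)]
  calc (∑ i ∈ s, Real.exp (-‖y i‖ ^ 2)) * V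
      ≤ ∑ i ∈ s, Real.exp (1 / 4) *
        ∫ z in Metric.ball (y i) (1 / 2), Real.exp (-(1 / 2) * ‖z‖ ^ 2) := by
        rw [Finset.sum_mul]
        exact Finset.sum_le_sum fun i _ => hball i
    _ = Real.exp (1 / 4) *
        ∫ z in ⋃ i ∈ s, Metric.ball (y i) (1 / 2), Real.exp (-(1 / 2) * ‖z‖ ^ 2) := by
        rw [← Finset.mul_sum, integral_biUnion_finset s (fun _ _ => measurableSet_ball) _
          fun i _ => hint.integrableOn]
        intro i hi j hj hij
        refine Metric.ball_disjoint_ball ?_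
        rw [dist_eq_norm]
        linarith [hy i hi j hj hij]
    _ ≤ Real.exp (1 / 4) * I := by
        gcongr
        exact setIntegral_le_integral hint (Filter.Eventually.of_forall fun z => (Real.exp_pos _).le)

/-- For a Gaussian kernel that is narrow compared with the separation of the points, the
off-diagonal row sums of the kernel matrix are small. -/
theorem exists_offdiag_sum_le (d : ℕ) :
    ∃ A : ℝ, 0 < A ∧ ∀ {ι : Type} [Fintype ι] [DecidableEq ι] (X : ι → Euc d) (q a : ℝ), 0 < q →
      A ≤ a * q ^ 2 → (∀ i j, i ≠ j → q ≤ ‖X i - X j‖) →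
      ∀ i, ∑ j ∈ Finset.univ.erase i, Real.exp (-a * ‖X i - X j‖ ^ 2) ≤ 1 / 2 := by
  obtain ⟨C, hC, hsum⟩ := exists_sum_exp_neg_sq_norm_le d
  -- For `u = ‖X i - X j‖/q ≥ 1`, each term is at most `exp(-2C) exp(-u²)`. The row sum is then at
  -- most `C exp(-2C) ≤ 1/2`.
  refine ⟨1 + 2 * C, by positivity, fun {ι} _ _ X q a hq ha hX i => ?_⟩
  have hscale (w : Euc d) : ‖q⁻¹ • w‖ = ‖w‖ / q := by
    rw [norm_smul, Real.norm_of_nonneg (by positivity), inv_mul_eq_div]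
  have h1 := hsum (Finset.univ.erase i) (fun j => q⁻¹ • (X i - X j)) fun j _ k _ hjk => by
    rw [← smul_sub, hscale, le_div_iff₀ hq, one_mul, sub_sub_sub_cancel_left]
    exact hX k j hjk.symm
  have h2 : ∀ j ∈ Finset.univ.erase i, Real.exp (-a * ‖X i - X j‖ ^ 2) ≤
      Real.exp (-(2 * C)) * Real.exp (-‖q⁻¹ • (X i - X j)‖ ^ 2) := fun j hj => by
    rw [← Real.exp_add, Real.exp_le_exp, hscale]
    have hle : 1 ≤ ‖X i - X j‖ / q := by
      rw [le_div_iff₀ hq, one_mul]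
      exact hX i j (Finset.ne_of_mem_erase hj).symm
    have he : a * ‖X i - X j‖ ^ 2 = a * q ^ 2 * (‖X i - X j‖ / q) ^ 2 := by
      field_simp
    have hsq : 1 ≤ (‖X i - X j‖ / q) ^ 2 := one_le_pow₀ hle
    rw [neg_mul, he]
    nlinarith
  calc ∑ j ∈ Finset.univ.erase i, Real.exp (-a * ‖X i - X j‖ ^ 2)
      ≤ Real.exp (-(2 * C)) * C := by
        refine (Finset.sum_le_sum h2).trans ?_
        rw [← Finset.mul_sum]
        gcongr
    _ ≤ 1 / 2 := by
        rw [Real.exp_neg, inv_mul_le_iff₀ (Real.exp_pos _)]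
        linarith [Real.add_one_le_exp (2 * C)]

/-- A symmetric matrix with unit diagonal and non-negative entries whose off-diagonal row sums are
at most `1/2` has its quadratic form bounded below by `1/2`. -/
theorem form_ge_of_offdiag_sum_le [DecidableEq ι] (G : ι → ι → ℝ) (hsymm : ∀ i j, G i j = G j i)
    (hnonneg : ∀ i j, 0 ≤ G i j) (hdiag : ∀ i, G i i = 1)
    (hoff : ∀ i, ∑ j ∈ Finset.univ.erase i, G i j ≤ 1 / 2) (v : ι → ℝ) :
    1 / 2 * ∑ i, v i ^ 2 ≤ ∑ i, ∑ j, v i * v j * G i j := by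
  have h1 (i : ι) : v i ^ 2 - ∑ j ∈ Finset.univ.erase i, (v i ^ 2 / 2 + v j ^ 2 / 2) * G i j ≤
      ∑ j, v i * v j * G i j := by
    rw [← Finset.add_sum_erase _ _ (Finset.mem_univ i), hdiag, sub_eq_add_neg,
      ← Finset.sum_neg_distrib]
    refine add_le_add (by linarith) (Finset.sum_le_sum fun j _ => ?_)
    nlinarith [mul_nonneg (sq_nonneg (v i + v j)) (hnonneg i j)]
  have hswap : ∑ i, ∑ j ∈ Finset.univ.erase i, v j ^ 2 / 2 * G i j =
      ∑ i, ∑ j ∈ Finset.univ.erase i, v i ^ 2 / 2 * G i j := by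
    rw [Finset.sum_comm' (t' := Finset.univ) (s' := fun j => Finset.univ.erase j)
      (by simp [eq_comm])]
    exact Finset.sum_congr rfl fun i _ => Finset.sum_congr rfl fun j _ => by rw [hsymm]
  have hrow : ∑ i, ∑ j ∈ Finset.univ.erase i, v i ^ 2 / 2 * G i j ≤ ∑ i, v i ^ 2 / 4 := by
    refine Finset.sum_le_sum fun i _ => ?_
    rw [← Finset.mul_sum]
    nlinarith [mul_le_mul_of_nonneg_left (hoff i) (sq_nonneg (v i))]
  have h2 := Finset.sum_le_sum fun i (_ : i ∈ Finset.univ) => h1 i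
  simp only [add_mul, Finset.sum_sub_distrib, Finset.sum_add_distrib] at h2
  rw [hswap] at h2
  rw [← Finset.sum_div] at hrow
  linarith

theorem exists_gaussian_form_ge (d : ℕ) :
    ∃ A : ℝ, 0 < A ∧ ∀ {ι : Type} [Fintype ι] (X : ι → Euc d) (q a : ℝ), 0 < q →
      A ≤ a * q ^ 2 → (∀ i j, i ≠ j → q ≤ ‖X i - X j‖) → ∀ v : ι → ℝ,
      1 / 2 * ∑ i, v i ^ 2 ≤ ∑ i, ∑ j, v i * v j * Real.exp (-a * ‖X i - X j‖ ^ 2) := by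
  classical
  obtain ⟨A, hA, h⟩ := exists_offdiag_sum_le d
  refine ⟨A, hA, fun X q a hq ha hX v => form_ge_of_offdiag_sum_le
    (fun i j => Real.exp (-a * ‖X i - X j‖ ^ 2)) (fun i j => ?_) (fun i j => (Real.exp_pos _).le)
    (fun i => by simp) (h X q a hq ha hX) v⟩
  simp only [norm_sub_rev]

end Gaussian

/-! ### The Matérn kernel as a Gaussian mixture, and its quadratic form. -/

section Mixture

/-- The Matérn profile is a mixture of Gaussians. -/
theorem maternProfile_eq_integral {ν r : ℝ} (hν : 0 < ν) (hr : 0 ≤ r) :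
    maternProfile ν r = 2 ^ (ν - 1) *
      ∫ s in Ioi (0 : ℝ), s ^ (ν - 1) * Real.exp (-s - r ^ 2 / (4 * s)) := by
  rcases hr.eq_or_lt with rfl | hr
  · rw [maternProfile, if_pos rfl, Real.Gamma_eq_integral hν]
    simp [mul_comm]
  · set b : ℝ := r ^ 2 / 4
    have hb : 0 < b := by positivity
    set g : ℝ → ℝ := fun t => t ^ (-ν - 1) * Real.exp (-t - r ^ 2 / (4 * t))
    -- The substitution `t = b/s`, done as a scaling followed by an inversion; it swaps the two
    -- terms in the exponent.
    have h1 : ∫ t in Ioi (0 : ℝ), g t = b * ∫ u in Ioi (0 : ℝ), g (b * u) := by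
      rw [integral_comp_mul_left_Ioi g 0 hb, mul_zero, smul_eq_mul, mul_inv_cancel_left₀ hb.ne']
    have h2 : ∫ u in Ioi (0 : ℝ), g (b * u) =
        ∫ s in Ioi (0 : ℝ), (|(-1 : ℝ)| * s ^ ((-1 : ℝ) - 1)) • g (b * s ^ (-1 : ℝ)) :=
      (integral_comp_rpow_Ioi (fun u => g (b * u)) (by norm_num)).symm
    have h3 : ∀ s ∈ Ioi (0 : ℝ), (|(-1 : ℝ)| * s ^ ((-1 : ℝ) - 1)) • g (b * s ^ (-1 : ℝ)) =
        b ^ (-ν - 1) * (s ^ (ν - 1) * Real.exp (-s - r ^ 2 / (4 * s))) := by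
      intro s hs
      have hs : 0 < s := hs
      have e1 : -(b * s ^ (-1 : ℝ)) - r ^ 2 / (4 * (b * s ^ (-1 : ℝ))) =
          -s - r ^ 2 / (4 * s) := by
        rw [Real.rpow_neg_one]
        simp only [b]
        field_simp
        ring
      simp only [g, e1, smul_eq_mul, abs_neg, abs_one, one_mul]
      rw [Real.mul_rpow hb.le (by positivity), ← Real.rpow_mul hs.le]
      have e2 : s ^ (ν - 1) = s ^ ((-1 : ℝ) - 1) * s ^ ((-1 : ℝ) * (-ν - 1)) := by
        rw [← Real.rpow_add hs]
        congr 1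
        ring
      rw [e2]
      ring
    have h4 : r ^ ν * ((1 / 2) * (r / 2) ^ ν) * (b * b ^ (-ν - 1)) = 2 ^ (ν - 1) := by
      have e1 : b * b ^ (-ν - 1) = (b ^ ν)⁻¹ := by
        rw [← Real.rpow_neg hb.le, Real.rpow_sub_one hb.ne', mul_div_cancel₀ _ hb.ne']
      have e2 : r ^ ν * (r / 2) ^ ν = 2 ^ ν * b ^ ν := by
        rw [← Real.mul_rpow hr.le (by positivity), ← Real.mul_rpow (by norm_num) hb.le]
        congr 1
        simp only [b]
        ring
      have hbν : b ^ ν ≠ 0 := (Real.rpow_pos_of_pos hb ν).ne'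
      rw [e1, Real.rpow_sub_one two_ne_zero]
      calc _ = (r ^ ν * (r / 2) ^ ν) * (1 / 2) * (b ^ ν)⁻¹ := by ring
        _ = _ := by rw [e2]; field_simp
    rw [maternProfile, if_neg hr.ne', besselK, ← h4]
    change r ^ ν * (_ * ∫ t in Ioi (0 : ℝ), g t) = _
    rw [h1, h2, setIntegral_congr_fun measurableSet_Ioi h3, integral_const_mul]
    ring

theorem integrableOn_mixture {ν : ℝ} (hν : 0 < ν) {k : ℝ} (hk : 0 ≤ k) :
    IntegrableOn (fun s : ℝ => s ^ (ν - 1) * Real.exp (-s) * Real.exp (-(k / s))) (Ioi 0) := by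
  have h : IntegrableOn (fun s : ℝ => s ^ (ν - 1) * Real.exp (-s)) (Ioi 0) := by
    simpa only [mul_comm] using Real.GammaIntegral_convergent hν
  refine h.mul_bdd (c := 1) (by fun_prop) ?_
  filter_upwards [ae_restrict_mem measurableSet_Ioi] with s hs
  have hs : 0 < s := hs
  rw [Real.norm_of_nonneg (Real.exp_pos _).le, Real.exp_le_one_iff, neg_nonpos]
  positivity

variable {d : ℕ}

theorem maternKernel_eq_integral {σ lam ν : ℝ} (hlam : 0 < lam) (hν : 0 < ν) (c : ℝ → ℝ)
    (x y : Euc d) :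
    maternKernel σ lam c ν x y = σ ^ 2 * c ν * 2 ^ (ν - 1) * ∫ s in Ioi (0 : ℝ),
      s ^ (ν - 1) * Real.exp (-s) * Real.exp (-(ν / (2 * lam ^ 2) * ‖x - y‖ ^ 2 / s)) := by
  rw [maternKernel, maternProfile_eq_integral hν (by positivity), ← mul_assoc]
  congr 1
  refine setIntegral_congr_fun measurableSet_Ioi fun s hs => ?_
  have hs : 0 < s := hs
  rw [mul_assoc, ← Real.exp_add, div_pow, mul_pow, Real.sq_sqrt (by positivity)]
  congr 2
  field_simp
  ring

/-- Replace `exp(-s)` by its minimum on the interval. This measures the mixing weight carried by the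
narrow Gaussians. -/
theorem integral_rpow_mul_exp_ge {ν s₀ : ℝ} (hν : 0 < ν) (hs₀ : 0 < s₀) :
    Real.exp (-s₀) * (s₀ ^ ν / ν) ≤ ∫ s in Ioc 0 s₀, s ^ (ν - 1) * Real.exp (-s) := by
  have h : IntegrableOn (fun s : ℝ => s ^ (ν - 1) * Real.exp (-s)) (Ioi 0) := by
    simpa only [mul_comm] using Real.GammaIntegral_convergent hν
  have hI : IntervalIntegrable (fun s : ℝ => s ^ (ν - 1)) volume 0 s₀ :=
    intervalIntegral.intervalIntegrable_rpow' (by linarith)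
  have h0 : ∫ s in Ioc 0 s₀, s ^ (ν - 1) = s₀ ^ ν / ν := by
    rw [← intervalIntegral.integral_of_le hs₀.le, integral_rpow (Or.inl (by linarith)),
      sub_add_cancel, Real.zero_rpow hν.ne', sub_zero]
  rw [← h0, ← integral_const_mul]
  refine setIntegral_mono_on (((intervalIntegrable_iff_integrableOn_Ioc_of_le hs₀.le).1 hI).const_mul
    _) (h.mono_set Ioc_subset_Ioi_self) measurableSet_Ioc fun s hs => ?_
  rw [mul_comm]
  have := hs.1
  gcongr
  exact hs.2

/-- Lower bound for the quadratic form of the Matérn kernel on separated points. -/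
theorem exists_matern_form_ge (d : ℕ) :
    ∃ A : ℝ, 0 < A ∧ ∀ {ι : Type} [Fintype ι] (X : ι → Euc d) (σ lam : ℝ) (c : ℝ → ℝ) (ν q : ℝ),
      0 < lam → 0 < ν → 0 ≤ c ν → 0 < q → (∀ i j, i ≠ j → q ≤ ‖X i - X j‖) → ∀ v : ι → ℝ,
      σ ^ 2 * c ν * 2 ^ (ν - 1) *
        (Real.exp (-(ν / (2 * lam ^ 2) * q ^ 2 / A)) *
          ((ν / (2 * lam ^ 2) * q ^ 2 / A) ^ ν / ν) * (1 / 2 * ∑ i, v i ^ 2)) ≤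
      ∑ i, ∑ j, v i * v j * maternKernel σ lam c ν (X i) (X j) := by
  obtain ⟨A, hA, hform⟩ := exists_gaussian_form_ge d
  refine ⟨A, hA, fun {ι} _ X σ lam c ν q hlam hν hc hq hX v => ?_⟩
  set b := ν / (2 * lam ^ 2)
  have hb : 0 < b := by positivity
  -- The threshold below which `(b/s) q² ≥ A`, so that the Gaussian coercivity bound applies.
  set s₀ := b * q ^ 2 / A
  have hs₀ : 0 < s₀ := by positivity
  set f : ℝ → ℝ := fun s => ∑ i, ∑ j, v i * v j *
    (s ^ (ν - 1) * Real.exp (-s) * Real.exp (-(b * ‖X i - X j‖ ^ 2 / s)))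
  have hint (i j : ι) : IntegrableOn (fun s : ℝ => v i * v j *
      (s ^ (ν - 1) * Real.exp (-s) * Real.exp (-(b * ‖X i - X j‖ ^ 2 / s)))) (Ioi 0) :=
    (integrableOn_mixture hν (by positivity)).const_mul _
  have hf : IntegrableOn f (Ioi 0) :=
    integrable_finsetSum _ fun i _ => integrable_finsetSum _ fun j _ => hint i j
  have hfs (s : ℝ) : f s = s ^ (ν - 1) * Real.exp (-s) *
      ∑ i, ∑ j, v i * v j * Real.exp (-(b / s) * ‖X i - X j‖ ^ 2) := by
    simp only [f, Finset.mul_sum]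
    refine Finset.sum_congr rfl fun i _ => Finset.sum_congr rfl fun j _ => ?_
    rw [show -(b * ‖X i - X j‖ ^ 2 / s) = -(b / s) * ‖X i - X j‖ ^ 2 by ring]
    ring
  have hf_nonneg : ∀ s ∈ Ioi (0 : ℝ), 0 ≤ f s := fun s hs => by
    have hs : 0 < s := hs
    rw [hfs]
    have := gaussian_form_nonneg (div_pos hb hs) X v
    positivity
  have hf_ge : ∀ s ∈ Ioc (0 : ℝ) s₀,
      s ^ (ν - 1) * Real.exp (-s) * (1 / 2 * ∑ i, v i ^ 2) ≤ f s := fun s hs => by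
    have hs0 := hs.1
    rw [hfs]
    refine mul_le_mul_of_nonneg_left (hform X q (b / s) hq ?_ hX v) (by positivity)
    have := hs.2
    rw [le_div_iff₀ hA] at this
    rw [div_mul_eq_mul_div, le_div_iff₀ hs0]
    linarith
  have hG : IntegrableOn (fun s : ℝ => s ^ (ν - 1) * Real.exp (-s)) (Ioi 0) := by
    simpa only [mul_comm] using Real.GammaIntegral_convergent hν
  have heq : ∑ i, ∑ j, v i * v j * maternKernel σ lam c ν (X i) (X j) =
      σ ^ 2 * c ν * 2 ^ (ν - 1) * ∫ s in Ioi 0, f s := by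
    rw [integral_finsetSum _ fun i _ => integrable_finsetSum _ fun j _ => hint i j,
      Finset.mul_sum]
    refine Finset.sum_congr rfl fun i _ => ?_
    rw [integral_finsetSum _ fun j _ => hint i j, Finset.mul_sum]
    refine Finset.sum_congr rfl fun j _ => ?_
    rw [integral_const_mul, maternKernel_eq_integral hlam hν]
    ring
  rw [heq]
  refine mul_le_mul_of_nonneg_left ?_ (by positivity)
  calc _ ≤ (∫ s in Ioc 0 s₀, s ^ (ν - 1) * Real.exp (-s)) * (1 / 2 * ∑ i, v i ^ 2) := by
        refine mul_le_mul_of_nonneg_right (integral_rpow_mul_exp_ge hν hs₀) ?_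
        have := Finset.sum_nonneg fun i (_ : i ∈ Finset.univ) => sq_nonneg (v i)
        positivity
    _ = ∫ s in Ioc 0 s₀, s ^ (ν - 1) * Real.exp (-s) * (1 / 2 * ∑ i, v i ^ 2) :=
        (integral_mul_const _ _).symm
    _ ≤ ∫ s in Ioc 0 s₀, f s :=
        setIntegral_mono_on ((hG.mono_set Ioc_subset_Ioi_self).mul_const _)
          (hf.mono_set Ioc_subset_Ioi_self) measurableSet_Ioc hf_ge
    -- The tail `s > s₀` contributes a non-negative amount, by positive semidefiniteness.
    _ ≤ ∫ s in Ioi 0, f s :=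
        setIntegral_mono_set hf ((ae_restrict_mem measurableSet_Ioi).mono hf_nonneg)
          Ioc_subset_Ioi_self.eventuallyLE

end Mixture

/-! ### Conditional variance as a Schur complement. -/

section CondVar

open Matrix

/-- If the quadratic form of the kernel on a finite family of points is at least `κ ‖v‖²`, then the
conditional variance at one of the points given the others is at least `κ`. -/
theorem condVar_erase_ge {E ι : Type*} [Fintype ι] [DecidableEq ι] (K : E → E → ℝ)
    (hK : ∀ x y, K x y = K y x) (X : ι → E) {κ : ℝ} (hκ : 0 < κ)
    (h : ∀ v : ι → ℝ, κ * ∑ i, v i ^ 2 ≤ ∑ i, ∑ j, v i * v j * K (X i) (X j)) (i : ι) :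
    κ ≤ condVar K (fun j : {j : ι // j ≠ i} => X j.1) (X i) := by
  set Y : {j : ι // j ≠ i} → E := fun j => X j.1
  set M := kernelMatrix K Y
  set k : {j : ι // j ≠ i} → ℝ := fun j => K (X i) (Y j)
  have hk' : (fun j => K (Y j) (X i)) = k := funext fun j => hK _ _
  have hsplit (f : ι → ℝ) : ∑ j, f j = f i + ∑ j : {j : ι // j ≠ i}, f j :=
    Fintype.sum_eq_add_sum_subtype_ne f i
  have hform (t : ℝ) (w : {j : ι // j ≠ i} → ℝ) :
      κ * (t ^ 2 + ∑ j, w j ^ 2) ≤ t ^ 2 * K (X i) (X i) + 2 * t * (k ⬝ᵥ w) + w ⬝ᵥ M *ᵥ w := by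
    set v : ι → ℝ := fun j => if hj : j = i then t else w ⟨j, hj⟩
    have hvi : v i = t := by simp [v]
    have hvj (j : {j : ι // j ≠ i}) : v j = w j := by simp [v, j.2]
    have := h v
    simp only [hsplit, hvi, hvj, Finset.sum_add_distrib] at this
    refine this.trans_eq ?_
    have e1 : ∑ j : {j : ι // j ≠ i}, w j * t * K (X j) (X i) = t * (k ⬝ᵥ w) := by
      rw [dotProduct, Finset.mul_sum]
      refine Finset.sum_congr rfl fun j _ => ?_
      rw [hK]
      ring
    have e2 : ∑ j : {j : ι // j ≠ i}, t * w j * K (X i) (X j) = t * (k ⬝ᵥ w) := by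
      rw [dotProduct, Finset.mul_sum]
      exact Finset.sum_congr rfl fun j _ => by ring
    have e3 : ∑ j : {j : ι // j ≠ i}, ∑ l : {j : ι // j ≠ i}, w j * w l * K (X j) (X l) =
        w ⬝ᵥ M *ᵥ w := by
      simp only [dotProduct, mulVec, Finset.mul_sum]
      refine Finset.sum_congr rfl fun j _ => Finset.sum_congr rfl fun l _ => ?_
      simp only [M, kernelMatrix, of_apply, Y]
      ring
    rw [e1, e2, e3]
    ring
  -- With `t = 0` the bound makes `M` definite, so `M⁻¹` is a genuine inverse.
  have hunit : IsUnit M := by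
    rw [← mulVec_injective_iff_isUnit, ← coe_mulVecLin, ← LinearMap.ker_eq_bot,
      LinearMap.ker_eq_bot']
    intro w hw
    rw [mulVecLin_apply] at hw
    have h0 := hform 0 w
    rw [hw] at h0
    simp only [dotProduct_zero] at h0
    have h1 : ∑ j, w j ^ 2 = 0 :=
      le_antisymm (by nlinarith) (Finset.sum_nonneg fun j _ => sq_nonneg _)
    rw [Finset.sum_eq_zero_iff_of_nonneg fun j _ => sq_nonneg _] at h1
    exact funext fun j => by simpa using h1 j (Finset.mem_univ j)
  set w := M⁻¹ *ᵥ k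
  have hMw : M *ᵥ w = k := by
    rw [mulVec_mulVec, mul_nonsing_inv _ ((isUnit_iff_isUnit_det _).1 hunit), one_mulVec]
  -- At `t = 1`, `-M⁻¹ k` is the minimiser of the form, and the value there is the conditional
  -- variance.
  have h1 := hform 1 (-w)
  rw [mulVec_neg, neg_dotProduct_neg, hMw, dotProduct_neg, dotProduct_comm w k] at h1
  have h2 : 0 ≤ ∑ j, (-w) j ^ 2 := Finset.sum_nonneg fun j _ => sq_nonneg _
  have h3 : condVar K Y (X i) = K (X i) (X i) - k ⬝ᵥ w := by
    rw [condVar, hk']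
  rw [h3]
  nlinarith

end CondVar

/-! ### Uniformity in `ν` and the main theorem. -/

theorem maternKernel_comm {d : ℕ} (σ lam : ℝ) (c : ℝ → ℝ) (ν : ℝ) (x y : Euc d) :
    maternKernel σ lam c ν x y = maternKernel σ lam c ν y x := by
  rw [maternKernel, maternKernel, norm_sub_rev]

/-- From `log ν ≥ 1 - 1/ν` follows `ν log ν ≥ ν - 1 ≥ -1`. -/
theorem exp_neg_one_le_rpow_self {ν : ℝ} (hν : 0 < ν) : Real.exp (-1) ≤ ν ^ ν := by
  rw [Real.rpow_def_of_pos hν, Real.exp_le_exp]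
  have h := mul_le_mul_of_nonneg_right (Real.one_sub_inv_le_log_of_pos hν) hν.le
  rw [sub_mul, inv_mul_cancel₀ hν.ne'] at h
  linarith

/-- Uniform lower bound for `exp (-s) s^ν / ν` at `s = ν B t²`, with `0 < t ≤ 1`. -/
theorem exp_mul_rpow_div_ge {B t ν ν₁ : ℝ} (hB : 0 < B) (ht : 0 < t) (ht1 : t ≤ 1) (hν : 0 < ν)
    (hν₁ : ν ≤ ν₁) :
    Real.exp (-(ν₁ * B)) * (Real.exp (-1) * min 1 B ^ ν₁ * t ^ (2 * ν₁) / ν₁) ≤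
      Real.exp (-(ν * B * t ^ 2)) * ((ν * B * t ^ 2) ^ ν / ν) := by
  have h1 : ν * B * t ^ 2 ≤ ν₁ * B := by
    have := pow_le_one₀ ht.le ht1 (n := 2)
    calc ν * B * t ^ 2 ≤ ν * B * 1 := by gcongr
      _ ≤ ν₁ * B := by rw [mul_one]; gcongr
  -- `B` may lie on either side of `1`; truncating at `1` makes the power decreasing in the
  -- exponent.
  have h2 : min 1 B ^ ν₁ ≤ B ^ ν :=
    (Real.rpow_le_rpow_of_exponent_ge (by positivity) (min_le_left _ _) hν₁).trans
      (Real.rpow_le_rpow (by positivity) (min_le_right _ _) hν.le)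
  have h3 : t ^ (2 * ν₁) ≤ (t ^ 2) ^ ν := by
    rw [← Real.rpow_natCast, ← Real.rpow_mul ht.le]
    exact Real.rpow_le_rpow_of_exponent_ge ht ht1 (by push_cast; linarith)
  rw [Real.mul_rpow (by positivity) (by positivity), Real.mul_rpow hν.le hB.le]
  have h4 := exp_neg_one_le_rpow_self hν
  have : 0 < min 1 B := by positivity
  have : 0 < ν₁ := hν.trans_le hν₁
  gcongr

end MaternLower

end

theorem mainTheorem5 {d : ℕ} (hd : 1 ≤ d)
    (σ lam : ℝ) (hσ : 0 < σ) (hlam : 0 < lam)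
    (c : ℝ → ℝ) (hc : ∀ ν₁ : ℝ, 0 < ν₁ → ∃ m > 0, ∀ ν ∈ Set.Ioc 0 ν₁, m ≤ c ν)
    (Ω : Set (MaternLower.Euc d)) (hΩ : MaternLower.IsAdmissibleDomain Ω)
    (x : ℕ → MaternLower.Euc d) (hx : MaternLower.IsQuasiUniform (closure Ω) x)
    (ν₁ : ℝ) (hν₁ : 0 < ν₁) :
    ∃ C₂ : ℝ, 0 < C₂ ∧ ∃ n₀ : ℕ, 0 < n₀ ∧
      ∀ n : ℕ, n₀ ≤ n → ∀ ν ∈ Set.Ioc 0 ν₁,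
        C₂ * (n : ℝ) ^ (-2 * ν₁ / (d : ℝ)) ≤
          ⨅ i : Fin n, MaternLower.looVar (MaternLower.maternKernel σ lam c ν) x n i := by
  obtain ⟨m, hm, hcm⟩ := hc ν₁ hν₁
  obtain ⟨a, ha, b, -, hfill⟩ := hx.fill
  obtain ⟨ρ, hρ, hsep⟩ := hx.sep
  obtain ⟨A, hA, hform⟩ := MaternLower.exists_matern_form_ge d
  -- Chosen so that `q = ρ a t` with `t = n^(-1/d)` turns the threshold `s₀` into `ν B t²`.
  set B := (ρ * a) ^ 2 / (2 * lam ^ 2 * A)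
  have hB : 0 < B := by positivity
  refine ⟨σ ^ 2 * m * (1 / 2) *
    (Real.exp (-(ν₁ * B)) * (Real.exp (-1) * min 1 B ^ ν₁ / ν₁) * (1 / 2)), ?_, 1, one_pos,
    fun n hn ν hν => ?_⟩
  · have : 0 < min 1 B := by positivity
    positivity
  -- The real infimum over an empty index type would be `0`; hence `n₀ = 1`.
  have : Nonempty (Fin n) := ⟨⟨0, hn⟩⟩
  have hn1 : (1 : ℝ) ≤ n := by exact_mod_cast hn
  have hn0 : (0 : ℝ) < n := by linarith
  set t : ℝ := (n : ℝ) ^ (-1 / (d : ℝ))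
  have ht : 0 < t := Real.rpow_pos_of_pos hn0 _
  have ht1 : t ≤ 1 := Real.rpow_le_one_of_one_le_of_nonpos hn1
    (div_nonpos_of_nonpos_of_nonneg (by norm_num) (Nat.cast_nonneg d))
  have hpow : (n : ℝ) ^ (-2 * ν₁ / (d : ℝ)) = t ^ (2 * ν₁) := by
    rw [← Real.rpow_mul hn0.le]
    congr 1
    ring
  have hX (i j : Fin n) (hij : i ≠ j) : ρ * (a * t) ≤ ‖x i - x j‖ :=
    (mul_le_mul_of_nonneg_left (hfill n hn).1 hρ.le).trans (hsep n i j hij)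
  have hcν := hcm ν hν
  have hν0 := hν.1
  have hs : ν / (2 * lam ^ 2) * (ρ * (a * t)) ^ 2 / A = ν * B * t ^ 2 := by
    simp only [B]
    field_simp
  have h2 : (1 / 2 : ℝ) ≤ 2 ^ (ν - 1) := by
    rw [Real.rpow_sub_one two_ne_zero]
    have := Real.one_le_rpow (one_le_two (α := ℝ)) hν.1.le
    linarith
  refine le_ciInf fun i => ?_
  refine le_trans ?_ (MaternLower.condVar_erase_ge (MaternLower.maternKernel σ lam c ν)
    (MaternLower.maternKernel_comm σ lam c ν) (fun j : Fin n => x j)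
    (κ := σ ^ 2 * c ν * 2 ^ (ν - 1) *
      (Real.exp (-(ν * B * t ^ 2)) * ((ν * B * t ^ 2) ^ ν / ν) * (1 / 2))) ?_ (fun v => ?_) i)
  · have h1 := MaternLower.exp_mul_rpow_div_ge hB ht ht1 hν.1 hν.2
    have hmin : 0 < min 1 B := by positivity
    rw [hpow]
    calc _ = σ ^ 2 * m * (1 / 2) * (Real.exp (-(ν₁ * B)) *
          (Real.exp (-1) * min 1 B ^ ν₁ * t ^ (2 * ν₁) / ν₁) * (1 / 2)) := by ring
      _ ≤ _ := by
        have := hm.trans_le hcν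
        gcongr
  · have : 0 < c ν := hm.trans_le hcν
    positivity
  · have := hform (fun j : Fin n => x j) σ lam c ν (ρ * (a * t)) hlam hν.1 (hm.le.trans hcν)
      (by positivity) hX v
    rw [hs] at this
    linarith
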